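/- Let $q=2^s$, let $n\ge 1$, let $\gamma_1,\dots,\gamma_n\in\mathbb F_q^*$ and let $R\ge 0$. For Galois qudits of dimension $q$ write $X^a|y\rangle=|y+a\rangle$ and $Z^b|y\rangle=(-1)^{\mathrm{tr}(by)}|y\rangle$ ($a,b,y\in\mathbb F_q$). To measure $\prod_k Z_k^{b_k}$ is to project, for an outcome $\eta\in\mathbb F_q$, onto the span of the $|y\rangle$ with $\sum_k b_ky_k=\eta$; an $X$-basis measurement with outcome $\nu$ projects onto $Z^\nu|+\rangle$, where $|+\rangle=q^{-1/2}\sum_a|a\rangle$. The qudit cat state $\mathsf{Cat}(\gamma_1,\dots,\gamma_n)$ is the $n$-qudit state stabilised by all $\prod_i X_i^{A\gamma_i}$ and all $Z_{i-1}^{A\gamma_i}Z_i^{A\gamma_{i-1}}$ ($2\le i\le n$, $A\in\mathbb F_q$). Consider the following preparation and verification procedure. (1) Prepare $n$ cat row qudits in $|+\rangle$. (2) For $i=2,\dots,n$ measure $Z_{i-1}^{\gamma_i}Z_i^{\gamma_{i-1}}$ (first all even $i$, then all odd $i$), and then apply an $X$-type frame update that makes all the reported outcomes trivial. (3) Repeat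 $R$ times: for $i=2,\dots,n$ (first even, then odd $i$), with $\alpha=\gamma_i$, $\beta=\gamma_{i-1}$, prepare two fresh ancilla qudits in $|+\rangle$; measure $Z^\alpha Z^\beta$ on them and apply an $X$-type frame update that makes the reported outcome trivial; measure $ZZ$ on cat qudit $i-1$ and the first ancilla, and on cat qudit $i$ and the second ancilla, with reported outcomes $\eta_1,\eta_2$; measure the ancillas in the $X$ basis, with reported outcomes $\nu_1,\nu_2$, and apply the frame update $Z_{i-1}^{\nu_1}Z_i^{\nu_2}$. The outcome of the check is $\alpha\eta_1+\beta\eta_2$. The state is accepted if every check in each of the $R$ rounds has outcome $0$. The operations (single-qudit preparations, two-qudit measurements, single-qudit $X$ measurements) are compiled in any way into elementary instructions, each belonging to one operation. An operation with at least one faulty instruction fails arbitrarily: a preparation leaves an arbitrary Pauli error on its qudit, a two-qudit measurement reports an arbitrary outcome and leaves an arbitrary Pauli error on the two qudits that it touches, an $X$ measurement reports an arbitrary outcome. All other operations, and the frame updates, work as intended. Then the procedure is $R$-fault-tolerant: in every execution that occurs with nonzero probability, if $f\le R$ instructions are faulty and the state is accepted, then the final state of the cat row is, up to a nonzero scalar,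 $P\,\mathsf{Cat}(\gamma_1,\dots,\gamma_n)$ for some Pauli operator $P$ that acts non-trivially on at most $f$ qudits. -/

import Mathlib

namespace QuditCat

/-! ## Galois qudits

`F` is a finite field of characteristic two, so `q = |F| = 2 ^ s`.  A (not necessarily normalised)
pure state of a register of qudits labelled by `κ` is its family of amplitudes in the
computational basis `|y⟩`, `y : κ → F`. -/

/-- Pure states of a register of qudits labelled by `κ`, as amplitude functions. -/
abbrev State (κ F : Type*) := (κ → F) → ℂ

/-- The sign `(-1) ^ tr(a)`, where `tr` is the trace from `F` to the field with two elements. -/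
noncomputable def phase {F : Type*} [Field F] [Algebra (ZMod 2) F] (a : F) : ℂ :=
  (-1) ^ (Algebra.trace (ZMod 2) F a).val

/-- Labels of Pauli operators: `⟨x, z⟩` is the label of `∏ₖ Xₖ^(x k) Zₖ^(z k)`. -/
@[ext]
structure Pauli (κ F : Type*) where
  x : κ → F
  z : κ → F

/-- The label of the identity operator. -/
def Pauli.one (κ F : Type*) [Zero F] : Pauli κ F := ⟨0, 0⟩

/-- The label of `∏ₖ Xₖ^(c k)`. -/
def Pauli.ofX {κ F : Type*} [Zero F] (c : κ → F) : Pauli κ F := ⟨c, 0⟩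

/-- The label of `∏ₖ Zₖ^(b k)`. -/
def Pauli.ofZ {κ F : Type*} [Zero F] (b : κ → F) : Pauli κ F := ⟨0, b⟩

/-- The action of `X^x Z^z`, where `X^a |y⟩ = |y + a⟩` and `Z^b |y⟩ = (-1) ^ tr(b y) |y⟩`. -/
noncomputable def Pauli.act {κ F : Type*} [Fintype κ] [Field F] [Algebra (ZMod 2) F]
    (P : Pauli κ F) (ψ : State κ F) : State κ F :=
  fun y => phase (∑ k, P.z k * (y k - P.x k)) * ψ (y - P.x)

/-- The number of qudits on which a Pauli operator is not the identity. -/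
noncomputable def Pauli.weight {κ F : Type*} [Zero F] (P : Pauli κ F) : ℕ :=
  Set.ncard {k | P.x k ≠ 0 ∨ P.z k ≠ 0}

/-- The state in which every qudit of the register is `|+⟩ = q^(-1/2) ∑ₐ |a⟩`. -/
noncomputable def plus (κ F : Type*) [Fintype κ] [Fintype F] : State κ F :=
  fun _ => (((Real.sqrt (Fintype.card F) : ℝ) : ℂ)⁻¹) ^ Fintype.card κ

/-- The tensor product of two states. -/
def tensor {κ l F : Type*} (ψ : State κ F) (φ : State l F) : State (κ ⊕ l) F :=
  fun y => ψ (fun k => y (Sum.inl k)) * φ (fun k => y (Sum.inr k))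

/-- The (unnormalised) state after the qudit operator `∏ₖ Zₖ^(b k)` was measured with outcome
`η : F`.  The measurement projects onto the joint eigenspace on which each `∏ₖ Zₖ^(A * b k)`,
`A : F`, has the eigenvalue `(-1) ^ tr(A η)`; it is spanned by the `|y⟩` with
`∑ₖ b k * y k = η`. -/
def measureZ {κ F : Type*} [Fintype κ] [Field F] [DecidableEq F]
    (b : κ → F) (η : F) (ψ : State κ F) : State κ F :=
  fun y => if ∑ k, b k * y k = η then ψ y else 0

/-- The (unnormalised) state of the remaining qudits `κ` after each qudit of `l` was destructively
measured in the `X` basis, with outcomes `ν`.  The basis vector for the outcome `ν` is `Z^ν |+⟩`,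
on which each `Xₖ^A` has the eigenvalue `(-1) ^ tr(A ν k)`. -/
noncomputable def readX {κ l F : Type*} [Fintype l] [DecidableEq l] [Field F] [Fintype F]
    [Algebra (ZMod 2) F] (ν : l → F) (Ψ : State (κ ⊕ l) F) : State κ F :=
  fun y => ∑ a : l → F, star ((Pauli.ofZ ν).act (plus l F) a) * Ψ (Sum.elim y a)

/-! ## The qudit cat state on `n = m + 1` qudits -/

/-- The exponents of the check `Z_j^(γ_(j+1)) Z_(j+1)^(γ_j)` on the pair `j, j + 1`. -/
def checkExp {m : ℕ} {F : Type*} [Field F] (γ : Fin (m + 1) → F) (j : Fin m) :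
    Fin (m + 1) → F :=
  Pi.single j.castSucc (γ j.succ) + Pi.single j.succ (γ j.castSucc)

/-- `φ` is a nonzero vector on the ray `Cat(γ)`: it is stabilised by the qudit stabilisers
`∏ᵢ Xᵢ^(γ i)` and `Z_j^(γ_(j+1)) Z_(j+1)^(γ_j)`.  That a qudit stabiliser fixes a state means that
all its powers with exponent `A : F` do. -/
def IsCat {m : ℕ} {F : Type*} [Field F] [Algebra (ZMod 2) F]
    (γ : Fin (m + 1) → F) (φ : State (Fin (m + 1)) F) : Prop :=
  φ ≠ 0 ∧ (∀ A : F, (Pauli.ofX (A • γ)).act φ = φ) ∧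
    ∀ (j : Fin m) (A : F), (Pauli.ofZ (A • checkExp γ j)).act φ = φ

/-! ## The procedure, with faults -/

/-- A run of one measurement of a `Z`-type qudit operator: the outcome that nature selected, the
outcome that was reported, and the Pauli error that was left behind. -/
structure MeasRun (κ F : Type*) where
  outcome : F
  reported : F
  error : Pauli κ F

/-- The effect of such a measurement of `∏ₖ Zₖ^(b k)` on the state. -/
noncomputable def MeasRun.act {κ F : Type*} [Fintype κ] [Field F] [DecidableEq F]
    [Algebra (ZMod 2) F] (b : κ → F) (M : MeasRun κ F) (ψ : State κ F) : State κ F :=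
  M.error.act (measureZ b M.outcome ψ)

/-- A faulty measurement may report any outcome and leave any Pauli error on the qudits that it
touches; a measurement that is not faulty reports its outcome and leaves no error. -/
def MeasRun.Possible {κ F : Type*} [Field F] (faulty : Prop) (b : κ → F) (M : MeasRun κ F) :
    Prop :=
  (∀ k, b k = 0 → M.error.x k = 0 ∧ M.error.z k = 0) ∧
    (¬ faulty → M.reported = M.outcome ∧ M.error = Pauli.one κ F)

/-- The elementary operations of the procedure with `R` rounds of checking.  Here `j` stands for
the neighbouring pair `j, j + 1` of the cat row, `r` for the checking round, and `b` for the first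
or second qudit of the pair. -/
inductive Op (m R : ℕ) where
  /-- preparation of a cat row qudit in `|+⟩` -/
  | prep (i : Fin (m + 1))
  /-- initial measurement of a check directly on the cat row -/
  | initMeas (j : Fin m)
  /-- preparation of an ancilla qudit in `|+⟩` -/
  | ancPrep (r : Fin R) (j : Fin m) (b : Fin 2)
  /-- measurement of `Z^α Z^β` on the two ancilla qudits -/
  | ancMeas (r : Fin R) (j : Fin m)
  /-- measurement of `Z Z` on a cat row qudit and its ancilla qudit -/
  | link (r : Fin R) (j : Fin m) (b : Fin 2)
  /-- destructive measurement of an ancilla qudit in the `X` basis -/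
  | ancRead (r : Fin R) (j : Fin m) (b : Fin 2)

/-- A run of the fault-tolerant `Z^α Z^β` measurement gadget: errors of the ancilla preparation,
the `Z^α Z^β` measurement on the ancillas and the ensuing frame update, the two `Z Z` measurements
between cat row and ancilla row, and the true and reported outcomes of the `X` measurements. -/
structure GadgetRun (m : ℕ) (F : Type*) where
  prepError : Pauli (Fin 2) F
  ancMeas : MeasRun (Fin 2) F
  frame : Fin 2 → F
  link : Fin 2 → MeasRun (Fin (m + 1) ⊕ Fin 2) F
  readOutcome : Fin 2 → F
  readReported : Fin 2 → F

/-- The two cat row qudits of the pair `j`. -/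
def pairQudit {m : ℕ} (j : Fin m) : Fin 2 → Fin (m + 1) := ![j.castSucc, j.succ]

/-- The exponents of the operator `Z Z` on a qudit of the pair `j` and its ancilla qudit. -/
def linkExp {m : ℕ} (F : Type*) [Field F] (j : Fin m) (b : Fin 2) : Fin (m + 1) ⊕ Fin 2 → F :=
  Pi.single (Sum.inl (pairQudit j b)) 1 + Pi.single (Sum.inr b) 1

/-- The exponents `![α, β]` of the check on the pair `j`. -/
def gadgetExp {m : ℕ} {F : Type*} (γ : Fin (m + 1) → F) (j : Fin m) : Fin 2 → F :=
  ![γ j.succ, γ j.castSucc]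

/-- The ancilla pair of the gadget just before it is coupled to the cat row. -/
noncomputable def GadgetRun.ancilla {m : ℕ} {F : Type*} [Field F] [Fintype F] [DecidableEq F]
    [Algebra (ZMod 2) F] (γ : Fin (m + 1) → F) (j : Fin m) (G : GadgetRun m F) :
    State (Fin 2) F :=
  (Pauli.ofX G.frame).act (G.ancMeas.act (gadgetExp γ j) (G.prepError.act (plus (Fin 2) F)))

/-- The effect of the gadget on the cat row: couple it to the ancillas by the two `Z Z`
measurements, measure out the ancillas in the `X` basis with outcomes `ν`, and apply the frame
update `Z^(ν 0) Z^(ν 1)` according to the reported outcomes. -/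
noncomputable def GadgetRun.act {m : ℕ} {F : Type*} [Field F] [Fintype F] [DecidableEq F]
    [Algebra (ZMod 2) F] (γ : Fin (m + 1) → F) (j : Fin m) (G : GadgetRun m F)
    (ψ : State (Fin (m + 1)) F) : State (Fin (m + 1)) F :=
  (Pauli.ofZ (∑ b, Pi.single (pairQudit j b) (G.readReported b))).act
    (readX G.readOutcome
      ((G.link 1).act (linkExp F j 1)
        ((G.link 0).act (linkExp F j 0)
          (tensor ψ (G.ancilla γ j)))))

/-- The outcome `α η₁ + β η₂` that the gadget reports. -/
def GadgetRun.result {m : ℕ} {F : Type*} [Field F] (γ : Fin (m + 1) → F) (j : Fin m)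
    (G : GadgetRun m F) : F :=
  ∑ b, gadgetExp γ j b * (G.link b).reported

/-- The gadget in round `r` on the pair `j` can run as described by `G` when exactly the operations
in `faulty` are faulty.  The frame update on the ancillas is any `X` operator that turns the
reported outcome of the `Z^α Z^β` measurement into the trivial one. -/
def GadgetRun.Possible {m R : ℕ} {F : Type*} [Field F] (faulty : Set (Op m R))
    (γ : Fin (m + 1) → F) (r : Fin R) (j : Fin m) (G : GadgetRun m F) : Prop :=
  (∀ b, Op.ancPrep r j b ∉ faulty → G.prepError.x b = 0 ∧ G.prepError.z b = 0) ∧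
  G.ancMeas.Possible (Op.ancMeas r j ∈ faulty) (gadgetExp γ j) ∧
  (∑ b, gadgetExp γ j b * G.frame b = G.ancMeas.reported) ∧
  (∀ b, (G.link b).Possible (Op.link r j b ∈ faulty) (linkExp F j b)) ∧
  (∀ b, Op.ancRead r j b ∉ faulty → G.readReported b = G.readOutcome b)

/-- A run of the whole procedure. -/
structure Run (m R : ℕ) (F : Type*) where
  prepError : Pauli (Fin (m + 1)) F
  init : Fin m → MeasRun (Fin (m + 1)) F
  frame : Fin (m + 1) → F
  check : Fin R → Fin m → GadgetRun m F

/-- The order of the `m` pairs in one round of measurements: a first layer of disjoint pairs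
`0, 2, 4, …` and a second layer of disjoint pairs `1, 3, 5, …`. -/
def layers (m : ℕ) : List (Fin m) :=
  (List.finRange m).filter (fun j => j.val % 2 = 0) ++
    (List.finRange m).filter (fun j => j.val % 2 = 1)

/-- The cat row after the non-fault-tolerant preparation: prepare `|+⟩` on every qudit, measure
all the checks, and apply the frame update. -/
noncomputable def Run.prepared {m R : ℕ} {F : Type*} [Field F] [Fintype F] [DecidableEq F]
    [Algebra (ZMod 2) F] (γ : Fin (m + 1) → F) (ρ : Run m R F) : State (Fin (m + 1)) F :=
  (Pauli.ofX ρ.frame).act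
    ((layers m).foldl (fun ψ j => (ρ.init j).act (checkExp γ j) ψ)
      (ρ.prepError.act (plus (Fin (m + 1)) F)))

/-- The (unnormalised) final state of the cat row, after `R` rounds of checking with the
fault-tolerant gadgets. -/
noncomputable def Run.final {m R : ℕ} {F : Type*} [Field F] [Fintype F] [DecidableEq F]
    [Algebra (ZMod 2) F] (γ : Fin (m + 1) → F) (ρ : Run m R F) : State (Fin (m + 1)) F :=
  (List.finRange R).foldl
    (fun ψ r => (layers m).foldl (fun ψ j => (ρ.check r j).act γ j ψ) ψ) (ρ.prepared γ)

/-- The procedure can run as described by `ρ` when exactly the operations in `faulty` are faulty: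
operations that are not faulty work as intended, the frame update after the initial measurements is
any `X` operator that turns all the reported outcomes into the trivial one, and the sequence
of outcomes has nonzero probability. -/
def Run.Possible {m R : ℕ} {F : Type*} [Field F] [Fintype F] [DecidableEq F]
    [Algebra (ZMod 2) F] (faulty : Set (Op m R)) (γ : Fin (m + 1) → F) (ρ : Run m R F) : Prop :=
  (∀ i, Op.prep i ∉ faulty → ρ.prepError.x i = 0 ∧ ρ.prepError.z i = 0) ∧
  (∀ j, (ρ.init j).Possible (Op.initMeas j ∈ faulty) (checkExp γ j)) ∧
  (∀ j, ∑ i, checkExp γ j i * ρ.frame i = (ρ.init j).reported) ∧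
  (∀ r j, (ρ.check r j).Possible faulty γ r j) ∧
  ρ.final γ ≠ 0

/-- The cat state is accepted if every check in every round reports the trivial outcome. -/
def Run.Accepted {m R : ℕ} {F : Type*} [Field F] (γ : Fin (m + 1) → F) (ρ : Run m R F) : Prop :=
  ∀ r j, (ρ.check r j).result γ j = 0

/-- The state `ψ` is `Cat(γ)` with errors on at most `s` qudits. -/
def HasErrorsOnAtMost {m : ℕ} {F : Type*} [Field F] [Algebra (ZMod 2) F]
    (γ : Fin (m + 1) → F) (s : ℕ) (ψ : State (Fin (m + 1)) F) : Prop :=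
  ∃ (P : Pauli (Fin (m + 1)) F) (φ : State (Fin (m + 1)) F),
    IsCat γ φ ∧ P.weight ≤ s ∧ ψ = P.act φ

/-- The preparation of `Cat(γ)` with `R` rounds of checking is `t`-fault-tolerant: however the
operations are compiled into instructions (`op i` is the operation to which the instruction `i`
belongs), if `s ≤ t` instructions are faulty, each of which makes its operation fail
arbitrarily, and the state is accepted, then it has errors on at most `s` qudits. -/
def IsFaultTolerant {m : ℕ} {F : Type*} [Field F] [Fintype F] [DecidableEq F]
    [Algebra (ZMod 2) F] (γ : Fin (m + 1) → F) (R t : ℕ) : Prop :=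
  ∀ (I : Type) (op : I → Op m R) (faults : Finset I) (ρ : Run m R F),
    faults.card ≤ t → ρ.Possible (op '' (faults : Set I)) γ → ρ.Accepted γ →
      HasErrorsOnAtMost γ faults.card (ρ.final γ)

end QuditCat

/-! The mechanism is a pigeonhole argument together with the fact that `Z` errors on a cat state
cost at most one qudit.

Once every check has been measured, the row is supported on a single coset `e + F • γ`, because all
`γ i` are nonzero (`eq_smul_of_syndrome_eq_zero`), and its amplitudes there are a multiple of the
phase of a linear form. Such a phase on a coset of a line is produced by a power of `Z` on any one
chosen qudit. If `e` is nonzero that qudit can be taken in the support of the `X` error, so only the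
`X` error has to be counted (`IsSyndromeState.hasErrorsOnAtMost`).

A gadget, however faulty, multiplies by an affine phase, shifts by the `X` errors of its links on
the row, and projects onto some value of its check (`GadgetRun.exists_act_eq`). Since all syndromes
are already definite, the projection either changes nothing or kills the state. All other faults of
the gadget affect only the phase and the selected value.

The preparation and the `R` rounds form `R + 1` stages, so `R` faults miss one of them. A faultless
preparation, or a faultless accepted round, ends with trivial syndromes
(`Run.exists_rounds_eq_final`). Thereafter `X` errors enter only through faulty links, each touching
one row qudit, so their support has at most as many elements as there are faults. Without any faults
there is no room even for one `Z` error, and the state is followed exactly by means of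
`IsCatMultiple`. -/

namespace QuditCat

/-! ## Phases -/

section Phase

variable {F : Type*} [Field F] [Algebra (ZMod 2) F]

theorem add_self_eq_zero_of_algebra (a : F) : a + a = 0 := by
  have : CharP F 2 := charP_of_injective_algebraMap (algebraMap (ZMod 2) F).injective 2
  exact CharTwo.add_self_eq_zero a

theorem phase_zero : phase (0 : F) = 1 := by simp [phase]

theorem phase_add (a b : F) : phase (a + b) = phase a * phase b := by
  have h : ∀ x y : ZMod 2, (-1 : ℂ) ^ (x + y).val = (-1) ^ x.val * (-1) ^ y.val := by
    intro x y
    rw [ZMod.val_add, ← pow_add]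
    exact (neg_one_pow_eq_pow_mod_two _).symm
  simp only [phase, map_add, h]

theorem phase_mul_self (a : F) : phase a * phase a = 1 := by
  rw [← phase_add, add_self_eq_zero_of_algebra, phase_zero]

theorem star_phase (a : F) : star (phase a) = phase a := by simp [phase]

end Phase

/-! ## Affine functions and affine phases -/

section Affine

variable {κ F : Type*} [Fintype κ] [Field F]

/-- `f` is an affine function on `κ → F`. -/
def IsAffine (f : (κ → F) → F) : Prop :=
  ∃ (z : κ → F) (c : F), ∀ y, f y = ∑ k, z k * y k + c

theorem IsAffine.const (c : F) : IsAffine (fun _ : κ → F => c) := ⟨0, c, by simp⟩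

theorem IsAffine.coord (k : κ) : IsAffine (fun y : κ → F => y k) := by
  classical
  exact ⟨Pi.single k 1, 0, by simp [Pi.single_apply]⟩

theorem IsAffine.add {f g : (κ → F) → F} (hf : IsAffine f) (hg : IsAffine g) :
    IsAffine (fun y => f y + g y) := by
  obtain ⟨z, c, hf⟩ := hf
  obtain ⟨w, d, hg⟩ := hg
  refine ⟨z + w, c + d, fun y => ?_⟩
  simp only [hf, hg, Pi.add_apply, add_mul, Finset.sum_add_distrib]
  ring

theorem IsAffine.const_mul {f : (κ → F) → F} (a : F) (hf : IsAffine f) :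
    IsAffine (fun y => a * f y) := by
  obtain ⟨z, c, hf⟩ := hf
  refine ⟨a • z, a * c, fun y => ?_⟩
  simp only [hf, mul_add, Finset.mul_sum, Pi.smul_apply, smul_eq_mul, mul_assoc]

theorem IsAffine.sub {f g : (κ → F) → F} (hf : IsAffine f) (hg : IsAffine g) :
    IsAffine (fun y => f y - g y) := by
  simpa [sub_eq_add_neg] using hf.add (hg.const_mul (-1))

theorem IsAffine.sum {ι : Type*} (s : Finset ι) {f : ι → (κ → F) → F}
    (hf : ∀ i, IsAffine (f i)) : IsAffine (fun y => ∑ i ∈ s, f i y) := by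
  classical
  induction s using Finset.induction_on with
  | empty => simpa using IsAffine.const (κ := κ) (0 : F)
  | insert i s hi ih => simpa [Finset.sum_insert hi] using (hf i).add ih

variable [Algebra (ZMod 2) F]

/-- `g` is a multiple of the phase of a linear form. -/
def IsAffinePhase (g : (κ → F) → ℂ) : Prop :=
  ∃ (c : ℂ) (z : κ → F), ∀ y, g y = c * phase (∑ k, z k * y k)

theorem IsAffinePhase.const (c : ℂ) : IsAffinePhase (fun _ : κ → F => c) :=
  ⟨c, 0, by simp [phase_zero]⟩

theorem IsAffinePhase.mul {f g : (κ → F) → ℂ} (hf : IsAffinePhase f) (hg : IsAffinePhase g) :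
    IsAffinePhase (fun y => f y * g y) := by
  obtain ⟨c, z, hf⟩ := hf
  obtain ⟨d, w, hg⟩ := hg
  refine ⟨c * d, z + w, fun y => ?_⟩
  simp only [hf, hg, Pi.add_apply, add_mul, Finset.sum_add_distrib, phase_add]
  ring

theorem IsAffine.phase {f : (κ → F) → F} (hf : IsAffine f) :
    IsAffinePhase (fun y => QuditCat.phase (f y)) := by
  obtain ⟨z, c, hf⟩ := hf
  refine ⟨QuditCat.phase c, z, fun y => ?_⟩
  simp only [hf, phase_add, mul_comm]

theorem IsAffinePhase.comp_sub {g : (κ → F) → ℂ} (hg : IsAffinePhase g) (e : κ → F) :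
    IsAffinePhase (fun y => g (y - e)) := by
  obtain ⟨c, z, hg⟩ := hg
  simp only [hg, Pi.sub_apply]
  exact (IsAffinePhase.const c).mul (IsAffine.phase (IsAffine.sum _ fun k =>
    ((IsAffine.coord k).sub (IsAffine.const _)).const_mul _))

end Affine

/-! ### Pauli operators acting on amplitudes -/

section Pauli

variable {κ F : Type*} [Fintype κ] [Field F] [Algebra (ZMod 2) F]

theorem Pauli.ofX_act (c : κ → F) (ψ : State κ F) (y : κ → F) :
    (Pauli.ofX c).act ψ y = ψ (y - c) := by
  simp [Pauli.act, Pauli.ofX, phase_zero]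

theorem Pauli.ofZ_act (b : κ → F) (ψ : State κ F) (y : κ → F) :
    (Pauli.ofZ b).act ψ y = phase (∑ k, b k * y k) * ψ y := by
  simp [Pauli.act, Pauli.ofZ]

theorem Pauli.one_act (ψ : State κ F) : (Pauli.one κ F).act ψ = ψ := by
  funext y
  simp [Pauli.act, Pauli.one, phase_zero]

omit [Fintype κ] [Algebra (ZMod 2) F] in
theorem Pauli.eq_one_of_forall {P : Pauli κ F} (h : ∀ k, P.x k = 0 ∧ P.z k = 0) :
    P = Pauli.one κ F :=
  Pauli.ext (funext fun k => (h k).1) (funext fun k => (h k).2)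

theorem Pauli.isAffinePhase_act {g : State κ F} (P : Pauli κ F) (hg : IsAffinePhase g) :
    IsAffinePhase (P.act g) :=
  (IsAffine.phase (IsAffine.sum _ fun k =>
    ((IsAffine.coord k).sub (IsAffine.const _)).const_mul _)).mul (hg.comp_sub P.x)

end Pauli

/-! ## Syndromes and cat states -/

section Cat

variable {m : ℕ} {F : Type*} [Field F]

/-- The value on `y` of the check on the pair `j`. -/
def syndrome (γ : Fin (m + 1) → F) (j : Fin m) (y : Fin (m + 1) → F) : F :=
  ∑ k, checkExp γ j k * y k

theorem syndrome_eq (γ : Fin (m + 1) → F) (j : Fin m) (y : Fin (m + 1) → F) :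
    syndrome γ j y = γ j.succ * y j.castSucc + γ j.castSucc * y j.succ := by
  simp [syndrome, checkExp, Pi.single_apply, add_mul, Finset.sum_add_distrib]

theorem syndrome_eq_gadgetExp (γ : Fin (m + 1) → F) (j : Fin m) (y : Fin (m + 1) → F) :
    syndrome γ j y = ∑ b, gadgetExp γ j b * y (pairQudit j b) := by
  simp [syndrome_eq, gadgetExp, pairQudit]

theorem syndrome_add (γ : Fin (m + 1) → F) (j : Fin m) (x y : Fin (m + 1) → F) :
    syndrome γ j (x + y) = syndrome γ j x + syndrome γ j y := by
  simp [syndrome, mul_add, Finset.sum_add_distrib]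

theorem syndrome_sub (γ : Fin (m + 1) → F) (j : Fin m) (x y : Fin (m + 1) → F) :
    syndrome γ j (x - y) = syndrome γ j x - syndrome γ j y := by
  simp [syndrome, mul_sub, Finset.sum_sub_distrib]

theorem syndrome_zero (γ : Fin (m + 1) → F) (j : Fin m) : syndrome γ j 0 = 0 := by
  simp [syndrome]

variable [Algebra (ZMod 2) F]

theorem syndrome_smul_self (γ : Fin (m + 1) → F) (j : Fin m) (A : F) :
    syndrome γ j (A • γ) = 0 := by
  rw [syndrome_eq, ← add_self_eq_zero_of_algebra (A * γ j.succ * γ j.castSucc)]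
  simp only [Pi.smul_apply, smul_eq_mul]
  ring

/-- In characteristic two a vanishing check says that the ratios `u i / γ i` of neighbours agree;
induction along the row carries the ratio at `0` to all qudits. -/
theorem eq_smul_of_syndrome_eq_zero {γ : Fin (m + 1) → F} (hγ : ∀ i, γ i ≠ 0)
    {u : Fin (m + 1) → F} (hu : ∀ j, syndrome γ j u = 0) : u = (u 0 / γ 0) • γ := by
  funext i
  simp only [Pi.smul_apply, smul_eq_mul]
  induction i using Fin.induction with
  | zero => field_simp [hγ 0]
  | succ j ih =>
    have h := hu j
    rw [syndrome_eq, ih] at h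
    have h2 := add_self_eq_zero_of_algebra (γ j.castSucc * (u 0 / γ 0 * γ j.succ))
    apply mul_left_cancel₀ (hγ j.castSucc)
    linear_combination h - h2

/-- `ψ` is an affine phase on the `y` whose syndromes on the pairs in `S` are given by `s`, and
vanishes elsewhere. -/
def IsSyndromeState (γ : Fin (m + 1) → F) (S : Set (Fin m)) (s : Fin m → F)
    (ψ : State (Fin (m + 1)) F) : Prop :=
  ∃ g, IsAffinePhase g ∧ ∀ y, ((∀ j ∈ S, syndrome γ j y = s j) → ψ y = g y) ∧
    ((¬ ∀ j ∈ S, syndrome γ j y = s j) → ψ y = 0)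

/-- Admitting the zero state for every `s` lets measurements with impossible outcomes be carried
along; nonvanishing is invoked only where a syndrome must be read off. -/
theorem IsSyndromeState.zero (γ : Fin (m + 1) → F) (S : Set (Fin m)) (s : Fin m → F) :
    IsSyndromeState γ S s 0 :=
  ⟨0, IsAffinePhase.const 0, fun _ => ⟨fun _ => rfl, fun _ => rfl⟩⟩

/-- Both Pauli operators and gadgets before their projection have this form; only the shift moves
the syndromes. -/
theorem IsSyndromeState.mul_comp_sub {γ : Fin (m + 1) → F} {S : Set (Fin m)} {s : Fin m → F}
    {ψ : State (Fin (m + 1)) F} (h : IsSyndromeState γ S s ψ) {g : (Fin (m + 1) → F) → ℂ}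
    (hg : IsAffinePhase g) (e : Fin (m + 1) → F) :
    IsSyndromeState γ S (fun j => s j + syndrome γ j e) (fun y => g y * ψ (y - e)) := by
  obtain ⟨f, hf, h⟩ := h
  refine ⟨fun y => g y * f (y - e), hg.mul (hf.comp_sub e), fun y => ?_⟩
  have h' := h (y - e)
  simp only [syndrome_sub, sub_eq_iff_eq_add] at h'
  exact ⟨fun hy => by simp only [h'.1 hy], fun hy => by simp only [h'.2 hy, mul_zero]⟩

theorem IsSyndromeState.act {γ : Fin (m + 1) → F} {S : Set (Fin m)} {s : Fin m → F}
    {ψ : State (Fin (m + 1)) F} (h : IsSyndromeState γ S s ψ) (P : Pauli (Fin (m + 1)) F) :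
    IsSyndromeState γ S (fun j => s j + syndrome γ j P.x) (P.act ψ) :=
  h.mul_comp_sub (IsAffine.phase (IsAffine.sum _ fun k =>
    ((IsAffine.coord k).sub (IsAffine.const _)).const_mul _)) P.x

/-- A check with a definite value has only one possible outcome: the projection keeps the state or
annihilates it. -/
theorem IsSyndromeState.measureZ_of_mem [DecidableEq F] {γ : Fin (m + 1) → F} {S : Set (Fin m)}
    {s : Fin m → F} {ψ : State (Fin (m + 1)) F} (h : IsSyndromeState γ S s ψ) {j : Fin m}
    (hj : j ∈ S) (η : F) :
    IsSyndromeState γ S s (QuditCat.measureZ (checkExp γ j) η ψ) ∧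
      (QuditCat.measureZ (checkExp γ j) η ψ ≠ 0 → s j = η) := by
  obtain ⟨f, hf, h⟩ := h
  by_cases hs : s j = η
  · refine ⟨⟨f, hf, fun y => ?_⟩, fun _ => hs⟩
    change (_ → (if syndrome γ j y = η then ψ y else 0) = f y) ∧
      (_ → (if syndrome γ j y = η then ψ y else 0) = 0)
    exact ⟨fun hy => by rw [if_pos ((hy j hj).trans hs), (h y).1 hy],
      fun hy => by rw [(h y).2 hy, ite_self]⟩
  · have h0 : QuditCat.measureZ (checkExp γ j) η ψ = 0 := by
      funext y
      change (if syndrome γ j y = η then ψ y else 0) = 0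
      split_ifs with hy
      · exact (h y).2 fun h' => hs ((h' j hj).symm.trans hy)
      · rfl
    exact ⟨h0 ▸ IsSyndromeState.zero _ _ _, fun h' => (h' h0).elim⟩

theorem IsSyndromeState.measureZ [DecidableEq F] {γ : Fin (m + 1) → F} {S : Set (Fin m)}
    {s : Fin m → F} {ψ : State (Fin (m + 1)) F} (h : IsSyndromeState γ S s ψ) (j : Fin m)
    (η : F) :
    ∃ s', IsSyndromeState γ (insert j S) s' (QuditCat.measureZ (checkExp γ j) η ψ) := by
  by_cases hj : j ∈ S
  · exact ⟨s, (Set.insert_eq_of_mem hj).symm ▸ (h.measureZ_of_mem hj η).1⟩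
  · obtain ⟨f, hf, h⟩ := h
    have hs : ∀ y, (∀ i ∈ insert j S, syndrome γ i y = Function.update s j η i) ↔
        syndrome γ j y = η ∧ ∀ i ∈ S, syndrome γ i y = s i := by
      intro y
      simp only [Set.forall_mem_insert, Function.update_self]
      refine and_congr_right fun _ => forall₂_congr fun i hi => ?_
      rw [Function.update_of_ne (ne_of_mem_of_not_mem hi hj)]
    refine ⟨Function.update s j η, f, hf, fun y => ?_⟩
    rw [hs]
    change (_ → (if syndrome γ j y = η then ψ y else 0) = f y) ∧
      (_ → (if syndrome γ j y = η then ψ y else 0) = 0)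
    refine ⟨fun hy => by rw [if_pos hy.1, (h y).1 hy.2], fun hy => ?_⟩
    split_ifs with h1
    · exact (h y).2 fun h2 => hy ⟨h1, h2⟩
    · rfl

theorem IsSyndromeState.smul {γ : Fin (m + 1) → F} {S : Set (Fin m)} {s : Fin m → F}
    {ψ : State (Fin (m + 1)) F} (h : IsSyndromeState γ S s ψ) (c : ℂ) :
    IsSyndromeState γ S s (c • ψ) := by
  have h' := h.mul_comp_sub (IsAffinePhase.const c) 0
  simp only [syndrome_zero, add_zero, sub_zero] at h'
  exact h'

theorem isCat_of_forall {γ : Fin (m + 1) → F} {c : ℂ} (hc : c ≠ 0)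
    {φ : State (Fin (m + 1)) F} (h1 : ∀ y, (∀ j, syndrome γ j y = 0) → φ y = c)
    (h0 : ∀ y, (¬ ∀ j, syndrome γ j y = 0) → φ y = 0) : IsCat γ φ := by
  refine ⟨fun h => hc ?_, fun A => funext fun y => ?_, fun j A => funext fun y => ?_⟩
  · rw [← h1 0 (syndrome_zero γ), h]; rfl
  · rw [Pauli.ofX_act]
    have hs : (∀ j, syndrome γ j (y - A • γ) = 0) ↔ ∀ j, syndrome γ j y = 0 := by
      simp [syndrome_sub, syndrome_smul_self]
    by_cases hy : ∀ j, syndrome γ j y = 0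
    · rw [h1 y hy, h1 _ (hs.2 hy)]
    · rw [h0 y hy, h0 _ (mt hs.1 hy)]
  · rw [Pauli.ofZ_act]
    by_cases hy : ∀ j, syndrome γ j y = 0
    · have : ∑ k, (A • checkExp γ j) k * y k = 0 := by
        have := hy j
        rw [syndrome] at this
        simp [mul_assoc, ← Finset.mul_sum, this]
      rw [this, phase_zero, one_mul]
    · rw [h0 y hy, mul_zero]

/-- A nonzero state whose syndrome is that of the `X` error `e` has errors at most on the support
of `e` and on any one other qudit. -/
theorem IsSyndromeState.hasErrorsOnAtMost {γ : Fin (m + 1) → F} (hγ : ∀ i, γ i ≠ 0)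
    {e : Fin (m + 1) → F} {ψ : State (Fin (m + 1)) F}
    (h : IsSyndromeState γ Set.univ (fun j => syndrome γ j e) ψ) (hψ : ψ ≠ 0)
    {D : Set (Fin (m + 1))} (he : ∀ k, e k ≠ 0 → k ∈ D) {t : ℕ} (hD : D.ncard ≤ t)
    (ht : 1 ≤ t) : HasErrorsOnAtMost γ t ψ := by
  classical
  obtain ⟨g, ⟨c, z, hg⟩, h⟩ := h
  simp only [Set.mem_univ, true_imp_iff] at h
  -- The qudit `k₀` will carry the whole `Z` error. It is free if it lies in `D`; if `D` is empty,
  -- `1 ≤ t` pays for it.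
  obtain ⟨k₀, hk₀⟩ : ∃ k₀, (insert k₀ D).ncard ≤ t := by
    obtain rfl | ⟨k₀, hk₀⟩ := D.eq_empty_or_nonempty
    · exact ⟨0, by simpa using ht⟩
    · exact ⟨k₀, by rwa [Set.insert_eq_of_mem hk₀]⟩
  -- Chosen so that `w * γ k₀ = ∑ k, z k * γ k`: along the line `F • γ`, `Z^w` on `k₀` gives the
  -- same phase as the full linear form `z`.
  set w := (∑ k, z k * γ k) / γ k₀ with hw
  have hc : c ≠ 0 := by
    rintro rfl
    refine hψ (funext fun y => ?_)
    by_cases hy : ∀ j, syndrome γ j y = syndrome γ j e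
    · simp [(h y).1 hy, hg]
    · exact (h y).2 hy
  have hp : phase (∑ k, z k * e k) ≠ 0 := fun h0 => by
    have := phase_mul_self (∑ k, z k * e k)
    simp [h0] at this
  refine ⟨⟨e, Pi.single k₀ w⟩,
    fun y => if ∀ j, syndrome γ j y = 0 then c * phase (∑ k, z k * e k) else 0,
    isCat_of_forall (mul_ne_zero hc hp) (fun y hy => if_pos hy) (fun y hy => if_neg hy), ?_, ?_⟩
  · refine (Set.ncard_le_ncard (fun k hk => ?_) (Set.toFinite _)).trans hk₀
    rcases hk with hk | hk
    · exact Set.mem_insert_of_mem _ (he k hk)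
    · left
      by_contra hne
      exact hk (by simp [hne])
  · funext y
    have hs : (∀ j, syndrome γ j (y - e) = 0) ↔ ∀ j, syndrome γ j y = syndrome γ j e := by
      simp [syndrome_sub, sub_eq_zero]
    simp only [Pauli.act]
    by_cases hy : ∀ j, syndrome γ j y = syndrome γ j e
    · rw [(h y).1 hy, hg, if_pos (hs.2 hy)]
      have hu := eq_smul_of_syndrome_eq_zero hγ (hs.2 hy)
      generalize (y - e) 0 / γ 0 = A at hu
      have hu' : ∀ k, y k - e k = A * γ k := fun k => congrFun hu k
      have hz : ∑ k, z k * y k = ∑ k, z k * e k + ∑ k, z k * (y k - e k) := by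
        rw [← Finset.sum_add_distrib]
        exact Finset.sum_congr rfl fun k _ => by ring
      have hsum : ∑ k, (Pi.single k₀ w : Fin (m + 1) → F) k * (y k - e k) =
          ∑ k, z k * (y k - e k) := by
        have : ∑ k, z k * (y k - e k) = (∑ k, z k * γ k) * A := by
          rw [Finset.sum_mul]
          exact Finset.sum_congr rfl fun k _ => by rw [hu']; ring
        rw [this]
        simp only [Pi.single_apply, ite_mul, zero_mul, Finset.sum_ite_eq', Finset.mem_univ,
          if_true, hu', hw]
        field_simp [hγ k₀]
      rw [hsum, hz, phase_add]
      ring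
    · rw [(h y).2 hy, if_neg (mt hs.1 hy), mul_zero]

end Cat

/-! ## The checking gadget -/

section Gadget

variable {m : ℕ} {F : Type*} [Field F] [Fintype F] [DecidableEq F] [Algebra (ZMod 2) F]

omit [Fintype F] [DecidableEq F] [Algebra (ZMod 2) F] in
theorem linkExp_sum (j : Fin m) (b : Fin 2) (y : Fin (m + 1) → F) (a : Fin 2 → F) :
    ∑ k, linkExp F j b k * (Sum.elim y a : Fin (m + 1) ⊕ Fin 2 → F) k =
      y (pairQudit j b) + a b := by
  simp [linkExp, Pi.single_apply]

omit [Fintype F] [DecidableEq F] [Algebra (ZMod 2) F] in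
theorem sum_elim_sub (P : Pauli (Fin (m + 1) ⊕ Fin 2) F) (y : Fin (m + 1) → F)
    (a : Fin 2 → F) :
    (Sum.elim y a : Fin (m + 1) ⊕ Fin 2 → F) - P.x =
      Sum.elim (y - P.x ∘ Sum.inl) (a - P.x ∘ Sum.inr) := by
  funext k
  cases k <;> rfl

omit [Fintype F] in
/-- A link measurement, with its errors, on the amplitude of `Sum.elim y a`. -/
theorem link_act_apply (M : MeasRun (Fin (m + 1) ⊕ Fin 2) F) (j : Fin m) (b : Fin 2)
    (Ψ : State (Fin (m + 1) ⊕ Fin 2) F) (y : Fin (m + 1) → F) (a : Fin 2 → F) :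
    M.act (linkExp F j b) Ψ (Sum.elim y a) =
      phase (∑ k, M.error.z k *
        ((Sum.elim y a : Fin (m + 1) ⊕ Fin 2 → F) k - M.error.x k)) *
        if (y - M.error.x ∘ Sum.inl) (pairQudit j b) + (a - M.error.x ∘ Sum.inr) b = M.outcome
        then Ψ (Sum.elim (y - M.error.x ∘ Sum.inl) (a - M.error.x ∘ Sum.inr)) else 0 := by
  simp only [MeasRun.act, Pauli.act, measureZ, sum_elim_sub, linkExp_sum]

omit [Field F] [DecidableEq F] [Algebra (ZMod 2) F] in
theorem plus_eq_const (κ : Type*) [Fintype κ] : ∃ c : ℂ, ∀ y, plus κ F y = c := ⟨_, fun _ => rfl⟩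

/-- The ancilla pair has amplitudes that are an affine phase on a single syndrome class. -/
theorem GadgetRun.exists_ancilla_eq (γ : Fin (m + 1) → F) (j : Fin m) (G : GadgetRun m F) :
    ∃ (g : (Fin 2 → F) → ℂ) (κ : F), IsAffinePhase g ∧ ∀ a, G.ancilla γ j a =
      if ∑ b, gadgetExp γ j b * a b = κ then g a else 0 := by
  have hplus : IsAffinePhase (plus (Fin 2) F) := IsAffinePhase.const _
  refine ⟨fun a => phase (∑ k, G.ancMeas.error.z k *
      ((a - G.frame) k - G.ancMeas.error.x k)) *
      G.prepError.act (plus (Fin 2) F) (a - G.frame - G.ancMeas.error.x),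
    G.ancMeas.outcome + ∑ b, gadgetExp γ j b * (G.frame b + G.ancMeas.error.x b), ?_,
    fun a => ?_⟩
  · have h1 : IsAffinePhase fun a : Fin 2 → F =>
        phase (∑ k, G.ancMeas.error.z k * (a k - G.ancMeas.error.x k)) :=
      IsAffine.phase (IsAffine.sum _ fun k =>
        ((IsAffine.coord k).sub (IsAffine.const _)).const_mul _)
    exact (h1.comp_sub G.frame).mul
      (((G.prepError.isAffinePhase_act hplus).comp_sub _).comp_sub G.frame)
  · have hs : ∑ b, gadgetExp γ j b * (a - G.frame - G.ancMeas.error.x) b = G.ancMeas.outcome ↔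
        ∑ b, gadgetExp γ j b * a b =
          G.ancMeas.outcome + ∑ b, gadgetExp γ j b * (G.frame b + G.ancMeas.error.x b) := by
      rw [← sub_eq_iff_eq_add, ← Finset.sum_sub_distrib]
      simp only [Pi.sub_apply, ← mul_sub, sub_sub]
    rw [GadgetRun.ancilla, Pauli.ofX_act]
    simp only [MeasRun.act, Pauli.act, measureZ, hs, mul_ite, mul_zero]

/-- The frame update has the same syndrome as the measured outcome, so it moves the ancilla pair to
the trivial class. -/
theorem GadgetRun.ancilla_eq_of_not_faulty {γ : Fin (m + 1) → F} {j : Fin m}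
    {G : GadgetRun m F} (hp : G.prepError = Pauli.one _ _)
    (hm : G.ancMeas.error = Pauli.one _ _)
    (hf : ∑ b, gadgetExp γ j b * G.frame b = G.ancMeas.outcome) :
    ∃ c : ℂ, ∀ a, G.ancilla γ j a = if ∑ b, gadgetExp γ j b * a b = 0 then c else 0 := by
  obtain ⟨c, hc⟩ := plus_eq_const (F := F) (Fin 2)
  refine ⟨c, fun a => ?_⟩
  have hs : ∑ b, gadgetExp γ j b * (a - G.frame) b = G.ancMeas.outcome ↔
      ∑ b, gadgetExp γ j b * a b = 0 := by
    simp only [Pi.sub_apply, mul_sub, Finset.sum_sub_distrib, hf]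
    rw [sub_eq_iff_eq_add, add_self_eq_zero_of_algebra]
  rw [GadgetRun.ancilla, Pauli.ofX_act, MeasRun.act, hp, hm, Pauli.one_act, Pauli.one_act]
  simp only [measureZ, hs, hc]

/-- The two link measurements determine the ancillas, so that at most one value of the ancillas
contributes to each amplitude of the final state. -/
theorem GadgetRun.act_apply (γ : Fin (m + 1) → F) (j : Fin m) (G : GadgetRun m F)
    (ψ : State (Fin (m + 1)) F) (y : Fin (m + 1) → F) (a : Fin 2 → F)
    (h1 : (y - (G.link 1).error.x ∘ Sum.inl) (pairQudit j 1) +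
      (a - (G.link 1).error.x ∘ Sum.inr) 1 = (G.link 1).outcome)
    (h0 : (y - (G.link 1).error.x ∘ Sum.inl - (G.link 0).error.x ∘ Sum.inl) (pairQudit j 0) +
      (a - (G.link 1).error.x ∘ Sum.inr - (G.link 0).error.x ∘ Sum.inr) 0 =
        (G.link 0).outcome) :
    G.act γ j ψ y =
      phase (∑ b, G.readReported b * y (pairQudit j b)) *
      (star (plus (Fin 2) F a) * phase (∑ b, G.readOutcome b * a b) *
      (phase (∑ k, (G.link 1).error.z k *
        ((Sum.elim y a : Fin (m + 1) ⊕ Fin 2 → F) k - (G.link 1).error.x k)) *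
      (phase (∑ k, (G.link 0).error.z k *
        ((Sum.elim (y - (G.link 1).error.x ∘ Sum.inl) (a - (G.link 1).error.x ∘ Sum.inr) :
          Fin (m + 1) ⊕ Fin 2 → F) k - (G.link 0).error.x k)) *
      (ψ (y - (G.link 1).error.x ∘ Sum.inl - (G.link 0).error.x ∘ Sum.inl) *
        G.ancilla γ j
          (a - (G.link 1).error.x ∘ Sum.inr - (G.link 0).error.x ∘ Sum.inr))))) := by
  have hframe : ∑ k, (∑ b, Pi.single (pairQudit j b) (G.readReported b) :
      Fin (m + 1) → F) k * y k = ∑ b, G.readReported b * y (pairQudit j b) := by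
    simp only [Finset.sum_apply, Finset.sum_mul]
    rw [Finset.sum_comm]
    simp [Pi.single_apply]
  rw [GadgetRun.act, Pauli.ofZ_act, hframe, readX, Finset.sum_eq_single a]
  · rw [link_act_apply, if_pos h1, link_act_apply, if_pos h0, Pauli.ofZ_act, star_mul',
      star_phase, mul_comm (phase (∑ b, G.readOutcome b * a b))]
    rfl
  · intro a' _ ha'
    rw [link_act_apply, link_act_apply]
    split_ifs with h1' h0'
    · refine (ha' (funext fun b => ?_)).elim
      have e1 := h1'.trans h1.symm
      have e0 := h0'.trans h0.symm
      simp only [Pi.sub_apply, add_right_inj, sub_left_inj] at e0 e1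
      fin_cases b
      · exact e0
      · exact e1
    all_goals simp
  · simp

/-- No assumption on faults is made: they can only influence `g`, `κ` and the shift, and the shift
comes from the links alone. -/
theorem GadgetRun.exists_act_eq (γ : Fin (m + 1) → F) (j : Fin m) (G : GadgetRun m F) :
    ∃ (g : (Fin (m + 1) → F) → ℂ) (κ : F), IsAffinePhase g ∧ ∀ ψ, G.act γ j ψ =
      measureZ (checkExp γ j) κ fun y => g y *
        ψ (y - ((G.link 1).error.x ∘ Sum.inl + (G.link 0).error.x ∘ Sum.inl)) := by
  obtain ⟨f, κ, ⟨d, w, hf⟩, hanc⟩ := G.exists_ancilla_eq γ j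
  obtain ⟨p, hp⟩ := plus_eq_const (F := F) (Fin 2)
  -- Obtained by solving the two link conditions for the ancillas. Link `1` acts last, so in terms
  -- of the final labels the condition of link `0` involves the shifts of both links, that of link
  -- `1` only its own.
  set t : Fin 2 → F := ![(G.link 0).outcome +
      (((G.link 1).error.x ∘ Sum.inl) + (G.link 0).error.x ∘ Sum.inl) (pairQudit j 0) +
        (((G.link 1).error.x ∘ Sum.inr) + (G.link 0).error.x ∘ Sum.inr) 0,
    (G.link 1).outcome + ((G.link 1).error.x ∘ Sum.inl) (pairQudit j 1) +
        ((G.link 1).error.x ∘ Sum.inr) 1] with ht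
  set a : (Fin (m + 1) → F) → Fin 2 → F := fun y b => t b - y (pairQudit j b) with ha
  have hat : ∀ b, IsAffine fun y => a y b := fun b => (IsAffine.const _).sub (IsAffine.coord _)
  set u := (G.link 1).error.x ∘ Sum.inr + (G.link 0).error.x ∘ Sum.inr with hu
  refine ⟨fun y => phase (∑ b, G.readReported b * y (pairQudit j b)) *
      (star p * phase (∑ b, G.readOutcome b * a y b) *
      (phase (∑ k, (G.link 1).error.z k *
        ((Sum.elim y (a y) : Fin (m + 1) ⊕ Fin 2 → F) k - (G.link 1).error.x k)) *
      (phase (∑ k, (G.link 0).error.z k *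
        ((Sum.elim (y - (G.link 1).error.x ∘ Sum.inl) (a y - (G.link 1).error.x ∘ Sum.inr) :
          Fin (m + 1) ⊕ Fin 2 → F) k - (G.link 0).error.x k)) *
        (d * phase (∑ b, w b * (a y b - u b)))))),
    ∑ b, gadgetExp γ j b * (t b - u b) - κ, ?_, fun ψ => funext fun y => ?_⟩
  · refine (IsAffine.phase (.sum _ fun b => (IsAffine.coord _).const_mul _)).mul
      (((IsAffinePhase.const _).mul (IsAffine.phase (.sum _ fun b => (hat b).const_mul _))).mul
      ((IsAffine.phase (.sum _ fun k => .const_mul _ (.sub ?_ (.const _)))).mul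
      ((IsAffine.phase (.sum _ fun k => .const_mul _ (.sub ?_ (.const _)))).mul
      ((IsAffinePhase.const _).mul (IsAffine.phase (.sum _ fun b =>
        .const_mul _ ((hat b).sub (.const _))))))))
    · cases k with
      | inl k => exact .coord k
      | inr b => exact hat b
    · cases k with
      | inl k => exact (IsAffine.coord k).sub (.const _)
      | inr b => exact (hat b).sub (.const _)
  · rw [G.act_apply γ j ψ y (a y) (by simp [ha, ht]; ring) (by simp [ha, ht, hu]; ring), hanc, hp,
      sub_sub, sub_sub, ← hu, hf]
    -- With the ancillas expressed through `y`, the syndrome class of the ancilla pair becomes a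
    -- value of the check on the row.
    have hs : ∑ b, gadgetExp γ j b * (a y - u) b = κ ↔
        ∑ k, checkExp γ j k * y k = ∑ b, gadgetExp γ j b * (t b - u b) - κ := by
      rw [← syndrome, syndrome_eq_gadgetExp, eq_sub_iff_add_eq, ← eq_sub_iff_add_eq',
        ← Finset.sum_sub_distrib, eq_comm]
      simp only [ha, Pi.sub_apply, ← mul_sub, sub_right_comm]
    simp only [measureZ, hs]
    split_ifs
    · simp only [Pi.sub_apply]
      ring
    · simp

theorem GadgetRun.exists_act_eq_of_not_faulty {R : ℕ} {faulty : Set (Op m R)}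
    {γ : Fin (m + 1) → F} {r : Fin R} {j : Fin m} {G : GadgetRun m F}
    (hG : G.Possible faulty γ r j) (hp : ∀ b, Op.ancPrep r j b ∉ faulty)
    (hm : Op.ancMeas r j ∉ faulty) (hl : ∀ b, Op.link r j b ∉ faulty)
    (hr : ∀ b, Op.ancRead r j b ∉ faulty) :
    ∃ c : ℂ, ∀ ψ, G.act γ j ψ = c • measureZ (checkExp γ j) (G.result γ j) ψ := by
  obtain ⟨h1, h2, h3, h4, h5⟩ := hG
  obtain ⟨hm1, hm2⟩ := h2.2 hm
  obtain ⟨d, hanc⟩ := GadgetRun.ancilla_eq_of_not_faulty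
    (Pauli.eq_one_of_forall fun b => h1 b (hp b)) hm2 (h3.trans hm1)
  obtain ⟨p, hplus⟩ := plus_eq_const (F := F) (Fin 2)
  have hx : ∀ b, (G.link b).error.x = 0 := fun b => by rw [((h4 b).2 (hl b)).2]; rfl
  have hz : ∀ b, (G.link b).error.z = 0 := fun b => by rw [((h4 b).2 (hl b)).2]; rfl
  have ho : ∀ b, (G.link b).reported = (G.link b).outcome := fun b => ((h4 b).2 (hl b)).1
  refine ⟨star p * d * phase (∑ b, G.readOutcome b * (G.link b).outcome),
    fun ψ => funext fun y => ?_⟩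
  have hx' : ∀ b, (G.link b).error.x ∘ Sum.inl = 0 ∧ (G.link b).error.x ∘ Sum.inr = 0 :=
    fun b => by rw [hx b]; exact ⟨rfl, rfl⟩
  rw [G.act_apply γ j ψ y (fun b => (G.link b).outcome - y (pairQudit j b))
    (by simp [hx']) (by simp [hx']), hplus]
  simp only [hx', sub_zero, hz, Pi.zero_apply, zero_mul, Finset.sum_const_zero, phase_zero,
    one_mul, hanc, fun b => h5 b (hr b)]
  have hs : ∑ b, gadgetExp γ j b * ((G.link b).outcome - y (pairQudit j b)) = 0 ↔
      ∑ k, checkExp γ j k * y k = G.result γ j := by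
    rw [← syndrome, syndrome_eq_gadgetExp, GadgetRun.result]
    simp only [mul_sub, Finset.sum_sub_distrib, ho]
    rw [sub_eq_zero, eq_comm]
  -- The `Z` frame update cancels the dependence on `y` of the phase from the `X` readout, leaving a
  -- constant.
  have hph : phase (∑ b, G.readOutcome b * y (pairQudit j b)) *
      phase (∑ b, G.readOutcome b * ((G.link b).outcome - y (pairQudit j b))) =
      phase (∑ b, G.readOutcome b * (G.link b).outcome) := by
    rw [← phase_add, ← Finset.sum_add_distrib]
    simp only [← mul_add, add_sub_cancel]
  simp only [hs, measureZ, Pi.smul_apply, smul_eq_mul, mul_ite, mul_zero, ← hph]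
  split_ifs <;> ring

end Gadget

/-! ## The whole procedure -/

section Procedure

variable {m R : ℕ} {F : Type*} [Field F] [Fintype F] [DecidableEq F] [Algebra (ZMod 2) F]

theorem mem_layers (j : Fin m) : j ∈ layers m := by
  rcases Nat.mod_two_eq_zero_or_one j.val with h | h <;> simp [layers, h]

/-- A property that every step preserves holds at the end if it holds at the start. -/
theorem foldl_invariant {α β : Type*} {p : β → Prop} {f : β → α → β}
    (hf : ∀ b a, p b → p (f b a)) (l : List α) {b : β} (hb : p b) : p (l.foldl f b) := by
  induction l generalizing b with
  | nil => exact hb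
  | cons a l ih => exact ih (hf b a hb)

omit [Fintype F] in
-- Each measurement makes one more check definite, and later Pauli errors shift the known values
-- without blurring them.
theorem IsSyndromeState.foldl_meas {γ : Fin (m + 1) → F}
    (M : Fin m → MeasRun (Fin (m + 1)) F) (l : List (Fin m)) {S : Set (Fin m)} {s : Fin m → F}
    {ψ : State (Fin (m + 1)) F} (h : IsSyndromeState γ S s ψ) :
    ∃ s', IsSyndromeState γ (S ∪ {j | j ∈ l}) s'
      (l.foldl (fun ψ j => (M j).act (checkExp γ j) ψ) ψ) := by
  induction l generalizing S s ψ with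
  | nil => exact ⟨s, by simpa using h⟩
  | cons j l ih =>
    obtain ⟨s₁, h₁⟩ := h.measureZ j (M j).outcome
    obtain ⟨s₂, h₂⟩ := ih (h₁.act (M j).error)
    refine ⟨s₂, ?_⟩
    have : S ∪ {i | i ∈ j :: l} = insert j S ∪ {i | i ∈ l} := by
      ext i
      simp [or_left_comm, or_assoc]
    rw [this]
    exact h₂

theorem Run.exists_isSyndromeState_prepared (γ : Fin (m + 1) → F) (ρ : Run m R F) :
    ∃ s, IsSyndromeState γ Set.univ s (ρ.prepared γ) := by
  have h : IsSyndromeState γ ∅ 0 (ρ.prepError.act (plus (Fin (m + 1)) F)) :=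
    ⟨_, ρ.prepError.isAffinePhase_act (IsAffinePhase.const _),
      fun y => ⟨fun _ => rfl, fun hy => (hy (by simp)).elim⟩⟩
  obtain ⟨s, hs⟩ := h.foldl_meas ρ.init (layers m)
  have : (∅ ∪ {j | j ∈ layers m} : Set (Fin m)) = Set.univ := by
    ext j
    simp [mem_layers]
  rw [this] at hs
  exact ⟨_, hs.act _⟩

omit [Fintype F] in
theorem foldl_meas_apply_of_error_eq_one {γ : Fin (m + 1) → F}
    {M : Fin m → MeasRun (Fin (m + 1)) F} (hM : ∀ j, (M j).error = Pauli.one _ _)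
    (l : List (Fin m)) (ψ : State (Fin (m + 1)) F) (y : Fin (m + 1) → F) :
    l.foldl (fun ψ j => (M j).act (checkExp γ j) ψ) ψ y =
      if ∀ j ∈ l, syndrome γ j y = (M j).outcome then ψ y else 0 := by
  induction l generalizing ψ with
  | nil => simp
  | cons j l ih =>
    rw [List.foldl_cons, ih, MeasRun.act, hM, Pauli.one_act]
    change (if _ then (if syndrome γ j y = (M j).outcome then ψ y else 0) else 0) = _
    simp only [List.forall_mem_cons]
    split_ifs <;> simp_all

/-- `ψ` is a multiple of the uniform superposition of the `y` with trivial syndromes. -/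
def IsCatMultiple (γ : Fin (m + 1) → F) (ψ : State (Fin (m + 1)) F) : Prop :=
  ∃ c : ℂ, ∀ y, ((∀ j, syndrome γ j y = 0) → ψ y = c) ∧
    ((¬ ∀ j, syndrome γ j y = 0) → ψ y = 0)

omit [Fintype F] [DecidableEq F] in
theorem IsCatMultiple.isSyndromeState {γ : Fin (m + 1) → F} {ψ : State (Fin (m + 1)) F}
    (h : IsCatMultiple γ ψ) : IsSyndromeState γ Set.univ (fun _ => 0) ψ := by
  obtain ⟨c, h⟩ := h
  exact ⟨fun _ => c, IsAffinePhase.const c, by simpa using h⟩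

omit [Fintype F] [Algebra (ZMod 2) F] in
theorem IsCatMultiple.smul_measureZ {γ : Fin (m + 1) → F} {ψ : State (Fin (m + 1)) F}
    (h : IsCatMultiple γ ψ) (c : ℂ) (j : Fin m) :
    IsCatMultiple γ (c • measureZ (checkExp γ j) 0 ψ) := by
  obtain ⟨d, h⟩ := h
  refine ⟨c * d, fun y => ?_⟩
  change (_ → c * (if syndrome γ j y = 0 then ψ y else 0) = _) ∧
    (_ → c * (if syndrome γ j y = 0 then ψ y else 0) = 0)
  exact ⟨fun hy => by rw [if_pos (hy j), (h y).1 hy],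
    fun hy => by rw [(h y).2 hy, ite_self, mul_zero]⟩

omit [Fintype F] [DecidableEq F] in
theorem IsCatMultiple.isCat {γ : Fin (m + 1) → F} {ψ : State (Fin (m + 1)) F}
    (h : IsCatMultiple γ ψ) (hψ : ψ ≠ 0) : IsCat γ ψ := by
  obtain ⟨c, h⟩ := h
  refine isCat_of_forall (c := c) ?_ (fun y => (h y).1) (fun y => (h y).2)
  rintro rfl
  exact hψ (funext fun y => by
    by_cases hy : ∀ j, syndrome γ j y = 0
    · exact (h y).1 hy
    · exact (h y).2 hy)

theorem Run.isCatMultiple_prepared {faulty : Set (Op m R)} {γ : Fin (m + 1) → F}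
    {ρ : Run m R F} (h : ρ.Possible faulty γ) (hp : ∀ i, Op.prep i ∉ faulty)
    (hi : ∀ j, Op.initMeas j ∉ faulty) : IsCatMultiple γ (ρ.prepared γ) := by
  obtain ⟨h1, h2, h3, -, -⟩ := h
  obtain ⟨c, hc⟩ := plus_eq_const (F := F) (Fin (m + 1))
  have hs : ∀ y, (∀ j ∈ layers m, syndrome γ j (y - ρ.frame) = (ρ.init j).outcome) ↔
      ∀ j, syndrome γ j y = 0 := by
    intro y
    refine ⟨fun h j => ?_, fun h j _ => ?_⟩
    · have := h j (mem_layers j)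
      rw [syndrome_sub, ← ((h2 j).2 (hi j)).1, ← h3 j, syndrome, syndrome,
        sub_eq_iff_eq_add, add_self_eq_zero_of_algebra] at this
      exact this
    · rw [syndrome_sub, ← ((h2 j).2 (hi j)).1, ← h3 j, h j, sub_eq_iff_eq_add]
      exact (add_self_eq_zero_of_algebra _).symm
  refine ⟨c, fun y => ?_⟩
  rw [Run.prepared, Pauli.ofX_act,
    foldl_meas_apply_of_error_eq_one fun j => ((h2 j).2 (hi j)).2,
    Pauli.eq_one_of_forall fun i => h1 i (hp i), Pauli.one_act, hc]
  simp only [hs]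
  exact ⟨fun hy => if_pos hy, fun hy => if_neg hy⟩

theorem GadgetRun.isSyndromeState_act {γ : Fin (m + 1) → F} {s : Fin m → F}
    {ψ : State (Fin (m + 1)) F} (h : IsSyndromeState γ Set.univ s ψ) (j : Fin m)
    (G : GadgetRun m F) :
    IsSyndromeState γ Set.univ (fun i => s i +
      syndrome γ i ((G.link 1).error.x ∘ Sum.inl + (G.link 0).error.x ∘ Sum.inl))
      (G.act γ j ψ) := by
  obtain ⟨g, κ, hg, hact⟩ := G.exists_act_eq γ j
  rw [hact]
  exact ((h.mul_comp_sub hg _).measureZ_of_mem (Set.mem_univ j) κ).1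

omit [Fintype F] [DecidableEq F] [Algebra (ZMod 2) F] in
-- This locality charges every row qudit with a new `X` error to a faulty link at that qudit.
theorem GadgetRun.Possible.exists_link_mem {faulty : Set (Op m R)} {γ : Fin (m + 1) → F}
    {r : Fin R} {j : Fin m} {G : GadgetRun m F} (h : G.Possible faulty γ r j) {k : Fin (m + 1)}
    (hk : ((G.link 1).error.x ∘ Sum.inl + (G.link 0).error.x ∘ Sum.inl) k ≠ 0) :
    ∃ b, Op.link r j b ∈ faulty ∧ pairQudit j b = k := by
  have hl := h.2.2.2.1
  have key : ∀ b, (G.link b).error.x (Sum.inl k) ≠ 0 →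
      Op.link r j b ∈ faulty ∧ pairQudit j b = k := by
    intro b hb
    constructor
    · by_contra hf
      rw [((hl b).2 hf).2] at hb
      exact hb rfl
    · by_contra hne
      refine hb ((hl b).1 (Sum.inl k) ?_).1
      simp [linkExp, Ne.symm hne]
  by_cases h1 : (G.link 1).error.x (Sum.inl k) = 0
  · exact ⟨0, key 0 fun h0 => hk (by simp [h0, h1])⟩
  · exact ⟨1, key 1 h1⟩

/-- The state of the cat row after the checks in the rounds `l`. -/
noncomputable def Run.rounds (γ : Fin (m + 1) → F) (ρ : Run m R F) (l : List (Fin R))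
    (ψ : State (Fin (m + 1)) F) : State (Fin (m + 1)) F :=
  l.foldl (fun ψ r => (layers m).foldl (fun ψ j => (ρ.check r j).act γ j ψ) ψ) ψ

theorem Run.rounds_invariant {γ : Fin (m + 1) → F} {ρ : Run m R F}
    {p : State (Fin (m + 1)) F → Prop} (hp : ∀ r j ψ, p ψ → p ((ρ.check r j).act γ j ψ))
    (l : List (Fin R)) {ψ : State (Fin (m + 1)) F} (hψ : p ψ) : p (ρ.rounds γ l ψ) :=
  foldl_invariant (fun _ r h => foldl_invariant (fun ψ j h => hp r j ψ h) _ h) l hψ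

/-- The round of checking in which an operation takes place, if there is one. -/
def Op.round : Op m R → Option (Fin R)
  | .prep _ => none
  | .initMeas _ => none
  | .ancPrep r _ _ => some r
  | .ancMeas r _ => some r
  | .link r _ _ => some r
  | .ancRead r _ _ => some r

/-- The cat row qudit that is touched by a link; a dummy value for other operations. -/
def Op.site : Op m R → Fin (m + 1)
  | .link _ j b => pairQudit j b
  | _ => 0

theorem GadgetRun.exists_act_eq_of_round {faulty : Set (Op m R)} {γ : Fin (m + 1) → F}
    {r : Fin R} {j : Fin m} {G : GadgetRun m F} (hG : G.Possible faulty γ r j)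
    (hr : ∀ o ∈ faulty, o.round ≠ some r) (h0 : G.result γ j = 0) :
    ∃ c : ℂ, ∀ ψ, G.act γ j ψ = c • measureZ (checkExp γ j) 0 ψ := by
  have := GadgetRun.exists_act_eq_of_not_faulty hG (fun b h => hr _ h rfl) (fun h => hr _ h rfl)
    (fun b h => hr _ h rfl) (fun b h => hr _ h rfl)
  rwa [h0] at this

/-- An accepted round of checking without faults leaves a state with trivial syndromes. -/
theorem Run.isSyndromeState_round {faulty : Set (Op m R)} {γ : Fin (m + 1) → F}
    {ρ : Run m R F} (h : ρ.Possible faulty γ) (hacc : ρ.Accepted γ) {r : Fin R}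
    (hr : ∀ o ∈ faulty, o.round ≠ some r) {s : Fin m → F} {ψ : State (Fin (m + 1)) F}
    (hψ : IsSyndromeState γ Set.univ s ψ) :
    IsSyndromeState γ Set.univ (fun _ => 0) (ρ.rounds γ [r] ψ) := by
  have key : ∀ l : List (Fin m),
      IsSyndromeState γ Set.univ s (l.foldl (fun ψ j => (ρ.check r j).act γ j ψ) ψ) ∧
      (l.foldl (fun ψ j => (ρ.check r j).act γ j ψ) ψ ≠ 0 → ∀ j ∈ l, s j = 0) := by
    intro l
    induction l using List.reverseRecOn with
    | nil => exact ⟨hψ, by simp⟩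
    | append_singleton l j ih =>
      obtain ⟨c, hc⟩ := GadgetRun.exists_act_eq_of_round (h.2.2.2.1 r j) hr (hacc r j)
      rw [List.foldl_append, List.foldl_cons, List.foldl_nil, hc]
      obtain ⟨h1, h2⟩ := ih.1.measureZ_of_mem (Set.mem_univ j) 0
      refine ⟨h1.smul c, fun hne i hi => ?_⟩
      have hne' := right_ne_zero_of_smul hne
      rcases List.mem_append.1 hi with hi | hi
      · refine ih.2 (fun h0 => hne' ?_) i hi
        rw [h0]
        funext y
        simp [measureZ]
      · rw [List.mem_singleton.1 hi]
        exact h2 hne'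
  obtain ⟨h1, h2⟩ := key (layers m)
  change IsSyndromeState γ Set.univ _ ((layers m).foldl _ ψ)
  -- If the state survives, every check had to agree with its accepted outcome, so `s` vanishes; a
  -- zero state has any syndrome.
  by_cases h0 : (layers m).foldl (fun ψ j => (ρ.check r j).act γ j ψ) ψ = 0
  · rw [h0]
    exact .zero _ _ _
  · rwa [← funext fun j => h2 h0 j (mem_layers j)]

/-- Trivial syndromes are left by a preparation without faults, and also by a round of checking
without faults. -/
theorem Run.exists_rounds_eq_final {I : Type} {op : I → Op m R} {faults : Finset I}
    {γ : Fin (m + 1) → F} {ρ : Run m R F} (hcard : faults.card ≤ R)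
    (h : ρ.Possible (op '' (faults : Set I)) γ) (hacc : ρ.Accepted γ) :
    ∃ (l : List (Fin R)) (ψ : State (Fin (m + 1)) F),
      IsSyndromeState γ Set.univ (fun _ => 0) ψ ∧ ρ.final γ = ρ.rounds γ l ψ := by
  classical
  -- `Option (Fin R)` has `R + 1` elements, `none` standing for the preparation stage, so at most
  -- `R` faults cannot hit them all.
  have hmiss : ∃ r : Option (Fin R), ∀ o ∈ op '' (faults : Set I), o.round ≠ r := by
    by_contra! hall
    have : (Finset.univ : Finset (Option (Fin R))) ⊆ faults.image fun i => (op i).round := by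
      intro r _
      obtain ⟨_, ⟨i, hi, rfl⟩, hr⟩ := hall r
      exact Finset.mem_image.2 ⟨i, hi, hr⟩
    have := (Finset.card_le_card this).trans Finset.card_image_le
    simp at this
    omega
  obtain ⟨_ | r, hr⟩ := hmiss
  · exact ⟨List.finRange R, _, (Run.isCatMultiple_prepared h (fun i hi => hr _ hi rfl)
      (fun j hj => hr _ hj rfl)).isSyndromeState, rfl⟩
  · obtain ⟨l₁, l₂, hl⟩ := List.append_of_mem (List.mem_finRange r)
    obtain ⟨s, hs⟩ : ∃ s, IsSyndromeState γ Set.univ s (ρ.rounds γ l₁ (ρ.prepared γ)) :=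
      Run.rounds_invariant (p := fun ψ => ∃ s, IsSyndromeState γ Set.univ s ψ)
        (fun r j ψ ⟨s, hs⟩ => ⟨_, GadgetRun.isSyndromeState_act hs j _⟩) l₁
        (ρ.exists_isSyndromeState_prepared γ)
    refine ⟨l₂, _, Run.isSyndromeState_round h hacc hr hs, ?_⟩
    rw [Run.final, hl, List.foldl_append, List.foldl_cons]
    rfl

theorem isFaultTolerant {γ : Fin (m + 1) → F} (hγ : ∀ i, γ i ≠ 0) : IsFaultTolerant γ R R := by
  intro I op faults ρ hcard h hacc
  have hne := h.2.2.2.2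
  -- The case of no faults is separate because `IsSyndromeState.hasErrorsOnAtMost` may spend one
  -- qudit on a `Z` error.
  rcases Nat.eq_zero_or_pos faults.card with hf | hf
  · have hno : ∀ o, o ∉ op '' (faults : Set I) := by simp [Finset.card_eq_zero.1 hf]
    have hfin : IsCatMultiple γ (ρ.final γ) := by
      refine Run.rounds_invariant (fun r j ψ hψ => ?_) (List.finRange R)
        (Run.isCatMultiple_prepared h (fun _ => hno _) (fun _ => hno _))
      obtain ⟨c, hc⟩ := GadgetRun.exists_act_eq_of_round (h.2.2.2.1 r j)
        (fun o ho => (hno o ho).elim) (hacc r j)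
      rw [hc]
      exact hψ.smul_measureZ c j
    exact ⟨Pauli.one _ _, _, hfin.isCat hne, by simp [Pauli.weight, Pauli.one],
      (Pauli.one_act _).symm⟩
  · obtain ⟨l, ψ, hψ, hfin⟩ := Run.exists_rounds_eq_final hcard h hacc
    -- As an image of the faults, `D` obeys the cardinality bound even though non-link faults
    -- contribute the irrelevant qudit `0`.
    set D : Set (Fin (m + 1)) := (fun i => (op i).site) '' (faults : Set I) with hD
    have hDcard : D.ncard ≤ faults.card := by
      simpa using Set.ncard_image_le (f := fun i => (op i).site) faults.finite_toSet
    obtain ⟨e, he, hs⟩ : ∃ e : Fin (m + 1) → F, (∀ k, e k ≠ 0 → k ∈ D) ∧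
        IsSyndromeState γ Set.univ (fun j => syndrome γ j e) (ρ.rounds γ l ψ) := by
      refine Run.rounds_invariant (p := fun ψ => ∃ e : Fin (m + 1) → F,
        (∀ k, e k ≠ 0 → k ∈ D) ∧ IsSyndromeState γ Set.univ (fun j => syndrome γ j e) ψ)
        (fun r j ψ ⟨e, he, hs⟩ => ?_) l ⟨0, by simp, by simpa [syndrome_zero] using hψ⟩
      have hs' := GadgetRun.isSyndromeState_act hs j (ρ.check r j)
      simp only [← syndrome_add] at hs'
      refine ⟨_, fun k hk => ?_, hs'⟩
      by_cases hek : e k = 0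
      · rw [Pi.add_apply, hek, zero_add] at hk
        obtain ⟨b, ⟨i, hi, hio⟩, hb⟩ := (h.2.2.2.1 r j).exists_link_mem hk
        exact ⟨i, hi, by simp only [hio]; exact hb⟩
      · exact he k hek
    rw [← hfin] at hs
    exact hs.hasErrorsOnAtMost hγ hne he hDcard hf

end Procedure

end QuditCat

theorem mainTheorem7 {F : Type*} [Field F] [Fintype F] [DecidableEq F] [Algebra (ZMod 2) F]
    (m R : ℕ) (γ : Fin (m + 1) → F) (hγ : ∀ i, γ i ≠ 0) :
    QuditCat.IsFaultTolerant γ R R :=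
  QuditCat.isFaultTolerant hγ
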